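/- Let $\beta$ be a positive even integer. For $N\in\mathbb{N}$, $N\ge 1$, let $$f(u,x)=-2u^2+\Big(1-\frac1N\Big)\ln(\mathrm{i}u+x),\qquad R_{N,\beta}(x)=\int_{-\infty}^{\infty}du_1\cdots\int_{-\infty}^{\infty}du_\beta\ \prod_{j=1}^{\beta}e^{Nf(u_j,x)}\prod_{1\le j<k\le\beta}|u_j-u_k|^{4/\beta}.$$ For real $x$ and $n\ge 1$ let $K_{n,\beta}(x)$ be the Kontsevich type integral $$K_{n,\beta}(x)=-\frac{n!}{(2\pi\mathrm{i})^{n}}\int_{\mathcal V_1}dv_1\cdots\int_{\mathcal V_n}dv_n\ \prod_{j=1}^n e^{v_j^3/3-xv_j}\prod_{1\le k<l\le n}(v_k-v_l)^{4/\beta},$$ where $\mathcal V_1$ is the vertical line from $c-\mathrm{i}\infty$ to $c+\mathrm{i}\infty$ for some $c>0$, where for $j\ge2$ the path $\mathcal V_j$ follows $\mathcal V_1$ but stops at $v_{j-1}$, and where the powers are principal. (For $n=\beta$ even this equals $\frac{1}{(2\pi\mathrm{i})^{\beta}}\int_{c-\mathrm{i}\infty}^{c+\mathrm{i}\infty}dv_1\cdots\int_{c-\mathrm{i}\infty}^{c+\mathrm{i}\infty}dv_\beta\prod_j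 e^{v_j^3/3-xv_j}\prod_{k<l}|v_k-v_l|^{4/\beta}$; for example $K_{2,2}(x)=2\big(\mathrm{Ai}'(x)^2-x\,\mathrm{Ai}(x)^2\big)$.) Then, for every real $x$ and every $c>0$, the integrals $R_{N,\beta}(y)$ ($N\ge1$, $y\in\mathbb{R}$) and $K_{\beta,\beta}(x)$ converge absolutely, and as $N\to\infty$ with $x$ and $\beta$ fixed $$R_{N,\beta}\Big(1+\frac{x}{2N^{2/3}}\Big)=\frac{e^{\beta N/2+\beta N^{1/3}x}}{2^{\beta N}}\left[\,4\Big(\frac{\pi}{2}\Big)^{\beta}\frac{1}{N^{\beta-2/3}}\,K_{\beta,\beta}(x)+\mathrm{O}\Big(\frac{1}{N^{\beta-1/3}}\Big)\right].$$ -/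

import Mathlib

open Filter Asymptotics MeasureTheory
open scoped Nat

noncomputable section

/-- The exponent function of the Hermite case,
`f(u, x) = -2 u² + ln(i u + x) - (1/N) ln(i u + x)`. It depends on `N`. -/
def hermiteF (N : ℕ) (u x : ℂ) : ℂ :=
  -2 * u ^ 2 + (1 - 1 / (N : ℂ)) * Complex.log (Complex.I * u + x)

/-- The integrand of `R_{N,β}(x)`:
`∏_j e^{N f(u_j, x)} · ∏_{j<k} |u_j - u_k|^{4/β}`, with all `u_j` real. -/
def hermiteIntegrand (N β : ℕ) (x : ℝ) (u : Fin β → ℝ) : ℂ :=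
  (∏ j, Complex.exp ((N : ℂ) * hermiteF N (u j : ℂ) (x : ℂ))) *
    ((∏ j, ∏ k ∈ Finset.Ioi j, |u j - u k| ^ (4 / (β : ℝ)) : ℝ) : ℂ)

/-- `R_{N,β}(x)`: the `β`-fold integral over the contour `(-∞, ∞)` in every variable. -/
def hermiteR (N β : ℕ) (x : ℝ) : ℂ :=
  ∫ u : Fin β → ℝ, hermiteIntegrand N β x u

/-- The vertical contour from `c - i∞` to `c + i∞`, parametrized by `t ↦ c + i t`. -/
def vert (c t : ℝ) : ℂ := (c : ℂ) + (t : ℂ) * Complex.I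

/-- The integrand of `K_{n,β}(x)` pulled back to the parameters `t`, with `v_j = c + i t_j`
and `dv_j = i dt_j`:
`∏_j i e^{v_j³/3 - x v_j} · ∏_{k<l} (v_k - v_l)^{4/β}`. The power is the principal one;
on the domain of integration `v_k - v_l` has positive imaginary part for `k < l`. -/
def kontsevichIntegrand (n : ℕ) (β c x : ℝ) (t : Fin n → ℝ) : ℂ :=
  (∏ j, Complex.I * Complex.exp (vert c (t j) ^ 3 / 3 - (x : ℂ) * vert c (t j))) *
    ∏ k, ∏ l ∈ Finset.Ioi k, (vert c (t k) - vert c (t l)) ^ ((4 / β : ℝ) : ℂ)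

/-- Parameters of the nested contours: `v_1` runs along the whole line, and `v_j` along its
part from `c - i∞` up to `v_{j-1}`, so that `t_1 > t_2 > ⋯ > t_n`. -/
def nested (n : ℕ) : Set (Fin n → ℝ) := {t | StrictAnti t}

/-- The Kontsevich type integral
`K_{n,β}(x) = - n!/(2πi)^n ∫_{V_1} dv_1 ⋯ ∫_{V_n} dv_n
  ∏_j e^{v_j³/3 - x v_j} ∏_{k<l} (v_k - v_l)^{4/β}`,
where `V_1` is the line `Re v = c` and `V_j` follows `V_1` but stops at `v_{j-1}`. -/
def kontsevichK (n : ℕ) (β c x : ℝ) : ℂ :=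
  -((n ! : ℂ) / (2 * (Real.pi : ℂ) * Complex.I) ^ n) *
    ∫ t in nested n, kontsevichIntegrand n β c x t

end

/-!
The integrand of `R_{N,β}(y)` is `∏_j h(u_j) · ∏_{j<k} |u_j - u_k|^{4/β}` with the entire function
`h(z) = e^{-2Nz²} (iz + y)^{N-1}`. The exponent has a double saddle point at `u = i/2` when `y = 1`,
so all contours have to be moved into the complex plane, although the weight
`|u_j - u_k|^{4/β}` is not analytic. A simultaneous translation of all variables avoids this
obstacle: the weight depends only on differences, the integral of
`∏_j h(u_j + ζ) · ∏ |u_j - u_k|^{4/β}` is entire in `ζ` and does not change under real translations,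
hence it is constant (`integral_prod_mul_absVandermonde_translate`).

With `ε = N^{-1/3}` and `y = 1 + xε²/2` the substitution `u = i/2 - i ε v/2`, `v = c + i t`, turns
`h` into an explicit constant times
`exp(-v/ε² + v²/(2ε) - x/ε) (1 + ε(v + xε))^{N-1}` (`hermiteR_eq`). Its exponent differs from
`v³/3 - xv` by `O(ε (1 + |t|)⁴)`, uniformly in `t`, because the Taylor remainders of `log (1 + z)`
are bounded on the whole half-plane `Re z ≥ 0` (`norm_scaledExponent_sub_cubic_le`). As the contour
passes the saddle point at distance `cε/2` with `c > 0`, both exponentials are dominated by a fixed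
Gaussian in `t` (`re_scaledExponent_le`). The `β`-fold integrals therefore converge with rate
`O(ε)` (`exists_norm_integral_sub_le`), the weight being of polynomial growth.

It remains to identify the limit with `K_{β,β}(x)`. The integral over the nested contours is
`1/β!` times the integral of the symmetric absolute integrand over the whole space
(`integral_eq_factorial_mul_setIntegral_nested`), and the phases of the principal powers multiply
to `e^{iπ(β-1)} = -1` for even `β` (`kontsevichK_eq`).
-/

/-! ### The absolute Vandermonde product -/

/-- The Vandermonde weight `∏_{j<k} |t_j - t_k|^a`. -/
noncomputable def absVandermonde {n : ℕ} (a : ℝ) (t : Fin n → ℝ) : ℝ :=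
  ∏ j, ∏ k ∈ Finset.Ioi j, |t j - t k| ^ a

theorem absVandermonde_nonneg {n : ℕ} (a : ℝ) (t : Fin n → ℝ) : 0 ≤ absVandermonde a t :=
  Finset.prod_nonneg fun _ _ => Finset.prod_nonneg fun _ _ => by positivity

theorem absVandermonde_add_const {n : ℕ} (a : ℝ) (t : Fin n → ℝ) (r : ℝ) :
    absVandermonde a (fun j => t j + r) = absVandermonde a t := by
  simp [absVandermonde]

theorem absVandermonde_eq_abs_det_rpow {n : ℕ} (a : ℝ) (t : Fin n → ℝ) :
    absVandermonde a t = |(Matrix.vandermonde t).det| ^ a := by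
  rw [Matrix.det_vandermonde, Finset.abs_prod, ← Real.finsetProd_rpow _ _ fun _ _ => abs_nonneg _]
  refine Finset.prod_congr rfl fun j _ => ?_
  rw [Finset.abs_prod, ← Real.finsetProd_rpow _ _ fun _ _ => abs_nonneg _]
  exact Finset.prod_congr rfl fun k _ => by rw [abs_sub_comm]

theorem absVandermonde_comp_perm {n : ℕ} (a : ℝ) (t : Fin n → ℝ) (σ : Equiv.Perm (Fin n)) :
    absVandermonde a (t ∘ σ) = absVandermonde a t := by
  have h : Matrix.vandermonde (t ∘ σ) = (Matrix.vandermonde t).submatrix σ id := by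
    ext i j
    simp [Matrix.vandermonde]
  rw [absVandermonde_eq_abs_det_rpow, absVandermonde_eq_abs_det_rpow, h, Matrix.det_permute,
    abs_mul]
  rcases Int.units_eq_one_or (Equiv.Perm.sign σ) with h | h <;> simp [h]

theorem continuous_absVandermonde {n : ℕ} {a : ℝ} (ha : 0 ≤ a) :
    Continuous (absVandermonde (n := n) a) := by
  refine continuous_finsetProd _ fun j _ => continuous_finsetProd _ fun k _ => ?_
  exact (by fun_prop : Continuous fun t : Fin n → ℝ => |t j - t k|).rpow_const fun _ => Or.inr ha

theorem sum_card_Ioi_mul_two (n : ℕ) :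
    (∑ j : Fin n, (Finset.Ioi j).card) * 2 = n * (n - 1) := by
  simp only [Fin.card_Ioi]
  rw [Fin.sum_univ_eq_sum_range (fun j => n - 1 - j) n, Finset.sum_range_reflect (fun j => j) n,
    Finset.sum_range_id_mul_two]

/-- A factor common to all pairs `j < k` contributes its `n(n-1)/2`-th power. -/
theorem prod_prod_Ioi_const {M : Type*} [CommMonoid M] (n : ℕ) (z : M) :
    ∏ j : Fin n, ∏ _k ∈ Finset.Ioi j, z = z ^ (n * (n - 1) / 2) := by
  simp only [Finset.prod_const]
  rw [Finset.prod_pow_eq_pow_sum, ← sum_card_Ioi_mul_two n, Nat.mul_div_cancel _ two_pos]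

theorem absVandermonde_smul {n : ℕ} (a : ℝ) {r : ℝ} (hr : 0 ≤ r) (t : Fin n → ℝ) :
    absVandermonde a (r • t) = (r ^ a) ^ (n * (n - 1) / 2) * absVandermonde a t := by
  rw [← prod_prod_Ioi_const n (r ^ a)]
  simp only [absVandermonde, ← Finset.prod_mul_distrib]
  refine Finset.prod_congr rfl fun j _ => Finset.prod_congr rfl fun k _ => ?_
  rw [← Real.mul_rpow hr (abs_nonneg _), Pi.smul_apply, Pi.smul_apply, smul_eq_mul, smul_eq_mul,
    ← mul_sub, abs_mul, abs_of_nonneg hr]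

/-- Polynomial growth of the Vandermonde weight, in a form that factorizes over the variables. -/
theorem absVandermonde_le {n : ℕ} {a : ℝ} (m : ℕ) (ha : 0 ≤ a) (ham : a ≤ m) (t : Fin n → ℝ) :
    absVandermonde a t ≤ ∏ j, (1 + |t j|) ^ (m * (n * (n - 1) / 2)) := by
  -- Each difference is at most `(1 + |t j|) (1 + |t k|)`, hence at most the full product `P`.
  set P : ℝ := ∏ j, (1 + |t j|) with hP
  have h1 : ∀ j ∈ Finset.univ, 1 ≤ 1 + |t j| := fun j _ => by linarith [abs_nonneg (t j)]
  have hP1 : 1 ≤ P := by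
    have := Finset.prod_le_prod (s := Finset.univ) (fun j _ => zero_le_one' ℝ) h1
    simpa using this
  have key : ∀ j, ∀ k ∈ Finset.Ioi j, |t j - t k| ≤ P := by
    intro j k hk
    have hjk : j ≠ k := (Finset.mem_Ioi.1 hk).ne
    have h2 : (1 + |t j|) * (1 + |t k|) ≤ P := by
      rw [hP, ← Finset.prod_pair (f := fun j => 1 + |t j|) hjk]
      exact Finset.prod_le_prod_of_subset_of_one_le (Finset.subset_univ _)
        (fun i _ => by positivity) (fun i hi _ => h1 i hi)
    have h3 := abs_sub (t j) (t k)
    nlinarith [abs_nonneg (t j), abs_nonneg (t k), mul_nonneg (abs_nonneg (t j)) (abs_nonneg (t k))]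
  calc absVandermonde a t ≤ ∏ j : Fin n, ∏ _k ∈ Finset.Ioi j, P ^ m := by
        refine Finset.prod_le_prod (fun j _ => Finset.prod_nonneg fun _ _ => by positivity)
          fun j _ => Finset.prod_le_prod (fun _ _ => by positivity) fun k hk => ?_
        calc |t j - t k| ^ a ≤ P ^ a := Real.rpow_le_rpow (abs_nonneg _) (key j k hk) ha
          _ ≤ P ^ (m : ℝ) := Real.rpow_le_rpow_of_exponent_le hP1 ham
          _ = P ^ m := Real.rpow_natCast _ _
    _ = _ := by rw [prod_prod_Ioi_const, ← pow_mul, hP, Finset.prod_pow]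

/-! ### Gaussian bounds and integrability -/

/-- A polynomial factor is absorbed by half of the Gaussian decay. -/
theorem one_add_abs_pow_mul_exp_neg_le {b : ℝ} (hb : 0 < b) (M : ℕ) (t : ℝ) :
    (1 + |t|) ^ M * Real.exp (-b * t ^ 2) ≤
      Real.exp (M ^ 2 / (2 * b)) * Real.exp (-(b / 2) * t ^ 2) := by
  have h1 : (1 + |t|) ^ M ≤ Real.exp (M * |t|) := by
    rw [Real.exp_nat_mul]
    gcongr
    linarith [Real.add_one_le_exp |t|]
  calc _ ≤ Real.exp (M * |t|) * Real.exp (-b * t ^ 2) := by gcongr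
    _ ≤ _ := by
      rw [← Real.exp_add, ← Real.exp_add]
      refine Real.exp_le_exp.2 ?_
      rw [← sq_abs t, ← sub_nonneg]
      have : (M : ℝ) ^ 2 / (2 * b) + -(b / 2) * |t| ^ 2 - (M * |t| + -b * |t| ^ 2)
          = (M - b * |t|) ^ 2 / (2 * b) := by
        field_simp
        ring
      rw [this]
      positivity

theorem integrable_prod_exp_mul_absVandermonde {n : ℕ} {a b : ℝ} (ha : 0 ≤ a) (hb : 0 < b) :
    Integrable fun t : Fin n → ℝ => (∏ j, Real.exp (-b * t j ^ 2)) * absVandermonde a t := by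
  obtain ⟨m, hm⟩ := exists_nat_ge a
  set M := m * (n * (n - 1) / 2) with hM
  have hg : Integrable fun t : ℝ =>
      Real.exp (M ^ 2 / (2 * b)) * Real.exp (-(b / 2) * t ^ 2) :=
    (integrable_exp_neg_mul_sq (half_pos hb)).const_mul _
  refine (Integrable.fintype_prod (f := fun _ : Fin n => fun t : ℝ =>
      Real.exp (M ^ 2 / (2 * b)) * Real.exp (-(b / 2) * t ^ 2)) fun _ => hg).mono'
    ((by fun_prop : Continuous fun t : Fin n → ℝ => ∏ j, Real.exp (-b * t j ^ 2)).mul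
      (continuous_absVandermonde ha)).aestronglyMeasurable (Eventually.of_forall fun t => ?_)
  have h0 : 0 ≤ ∏ j, Real.exp (-b * t j ^ 2) := Finset.prod_nonneg fun _ _ => by positivity
  rw [Real.norm_of_nonneg (mul_nonneg h0 (absVandermonde_nonneg a t))]
  calc _ ≤ (∏ j, Real.exp (-b * t j ^ 2)) * ∏ j, (1 + |t j|) ^ M :=
        mul_le_mul_of_nonneg_left (absVandermonde_le m ha hm t) h0
    _ ≤ _ := by
      rw [← Finset.prod_mul_distrib]
      refine Finset.prod_le_prod (fun _ _ => by positivity) fun j _ => ?_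
      rw [mul_comm]
      exact one_add_abs_pow_mul_exp_neg_le hb M (t j)

theorem norm_prod_mul_absVandermonde_le {n : ℕ} (a : ℝ) {b C : ℝ} {g : ℝ → ℂ}
    (hg : ∀ t, ‖g t‖ ≤ C * Real.exp (-b * t ^ 2)) (t : Fin n → ℝ) :
    ‖(∏ j, g (t j)) * (absVandermonde a t : ℂ)‖ ≤
      C ^ n * ((∏ j, Real.exp (-b * t j ^ 2)) * absVandermonde a t) := by
  rw [norm_mul, Complex.norm_of_nonneg (absVandermonde_nonneg a t), norm_prod, ← mul_assoc]
  refine mul_le_mul_of_nonneg_right ?_ (absVandermonde_nonneg a t)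
  calc _ ≤ ∏ j, C * Real.exp (-b * t j ^ 2) :=
        Finset.prod_le_prod (fun _ _ => norm_nonneg _) fun j _ => hg (t j)
    _ = _ := by rw [Finset.prod_mul_distrib]; simp

theorem integrable_prod_mul_absVandermonde {n : ℕ} {a b C : ℝ} {g : ℝ → ℂ} (ha : 0 ≤ a)
    (hb : 0 < b) (hc : Continuous g) (hg : ∀ t, ‖g t‖ ≤ C * Real.exp (-b * t ^ 2)) :
    Integrable fun t : Fin n → ℝ => (∏ j, g (t j)) * (absVandermonde a t : ℂ) := by
  have hV := continuous_absVandermonde (n := n) ha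
  exact ((integrable_prod_exp_mul_absVandermonde ha hb).const_mul (C ^ n)).mono'
    (by fun_prop : Continuous fun t : Fin n → ℝ =>
      (∏ j, g (t j)) * (absVandermonde a t : ℂ)).aestronglyMeasurable
    (Eventually.of_forall (norm_prod_mul_absVandermonde_le a hg))

/-! ### Simultaneous translation of all contours -/

/-- The weight depends on the differences only, so real simultaneous translations leave the
integral unchanged; as it is an entire function of the translation, its derivative vanishes
and complex translations leave it unchanged as well. -/
theorem integral_prod_mul_absVandermonde_translate {n : ℕ} {a : ℝ} (ha : 0 ≤ a) {h : ℂ → ℂ}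
    (hd : Differentiable ℂ h)
    (hb : ∀ ρ : ℝ, ∃ C b : ℝ, 0 < b ∧
      ∀ ζ : ℂ, ‖ζ‖ ≤ ρ → ∀ u : ℝ, ‖h (u + ζ)‖ ≤ C * Real.exp (-b * u ^ 2)) (ζ : ℂ) :
    ∫ u : Fin n → ℝ, (∏ j, h (u j + ζ)) * (absVandermonde a u : ℂ) =
      ∫ u : Fin n → ℝ, (∏ j, h (u j)) * (absVandermonde a u : ℂ) := by
  set F : ℂ → (Fin n → ℝ) → ℂ := fun ζ u => (∏ j, h (u j + ζ)) * (absVandermonde a u : ℂ) with hF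
  have hV := continuous_absVandermonde (n := n) ha
  have hcont : Continuous h := hd.continuous
  have hcont' : Continuous (deriv h) := (hd.contDiff (n := 1)).continuous_deriv le_rfl
  have hFc : ∀ ζ, Continuous (F ζ) := fun ζ => by fun_prop
  have hFd : ∀ u, Differentiable ℂ fun ζ => F ζ u := fun u => by fun_prop
  have hderiv : ∀ ζ, HasDerivAt (fun ζ => ∫ u, F ζ u) (∫ u, deriv (fun ζ => F ζ u) ζ) ζ := by
    intro ζ₀
    obtain ⟨C, b, hb0, hC⟩ := hb (‖ζ₀‖ + 2)
    have hbd : ∀ ζ : ℂ, ‖ζ‖ ≤ ‖ζ₀‖ + 2 → ∀ u, ‖F ζ u‖ ≤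
        C ^ n * ((∏ j, Real.exp (-b * u j ^ 2)) * absVandermonde a u) := fun ζ hζ u =>
      norm_prod_mul_absVandermonde_le a (g := fun u => h (u + ζ)) (hC ζ hζ) u
    have hder : ∀ u, deriv (fun ζ => F ζ u) ζ₀ =
        (∑ i, (∏ j ∈ Finset.univ.erase i, h (u j + ζ₀)) * deriv h (u i + ζ₀)) *
          (absVandermonde a u : ℂ) := by
      intro u
      have h1 : ∀ i ∈ Finset.univ, HasDerivAt (fun ζ => h (u i + ζ)) (deriv h (u i + ζ₀)) ζ₀ :=
        fun i _ => (hd _).hasDerivAt.comp_const_add _ _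
      have h2 := (HasDerivAt.fun_finsetProd h1).mul_const (absVandermonde a u : ℂ)
      simpa only [smul_eq_mul] using h2.deriv
    refine (hasDerivAt_integral_of_dominated_loc_of_deriv_le
      (F' := fun ζ u => deriv (fun ζ => F ζ u) ζ)
      (bound := fun u => C ^ n * ((∏ j, Real.exp (-b * u j ^ 2)) * absVandermonde a u))
      (Metric.ball_mem_nhds ζ₀ one_pos)
      (Eventually.of_forall fun ζ => (hFc ζ).aestronglyMeasurable) ?_ ?_ ?_ ?_ ?_).2
    · exact integrable_prod_mul_absVandermonde (g := fun u => h (u + ζ₀)) ha hb0 (by fun_prop)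
        (hC ζ₀ (by linarith))
    · simp only [hder]
      exact (by fun_prop : Continuous fun u : Fin n → ℝ =>
        (∑ i, (∏ j ∈ Finset.univ.erase i, h (u j + ζ₀)) * deriv h (u i + ζ₀)) *
          (absVandermonde a u : ℂ)).aestronglyMeasurable
    -- Cauchy's estimate on circles of radius 1 bounds the derivative by the bound on `F` itself.
    · refine Eventually.of_forall fun u ζ hζ => ?_
      have := Complex.norm_deriv_le_of_forall_mem_sphere_norm_le one_pos
        (hFd u).diffContOnCl (fun z hz => hbd z ?_ u) (c := ζ)
      · simpa using this
      · have h1 : ‖z - ζ‖ = 1 := by simpa [dist_eq_norm] using hz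
        have h2 : ‖ζ - ζ₀‖ < 1 := by simpa [dist_eq_norm] using hζ
        calc ‖z‖ = ‖(z - ζ) + (ζ - ζ₀) + ζ₀‖ := by ring_nf
          _ ≤ ‖z - ζ‖ + ‖ζ - ζ₀‖ + ‖ζ₀‖ := norm_add₃_le
          _ ≤ ‖ζ₀‖ + 2 := by linarith
    · exact (integrable_prod_exp_mul_absVandermonde ha hb0).const_mul _
    · exact Eventually.of_forall fun u ζ _ => (hFd u ζ).hasDerivAt
  have hreal : ∀ (ζ : ℂ) (r : ℝ), ∫ u, F (ζ + r) u = ∫ u, F ζ u := by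
    intro ζ r
    rw [← integral_add_right_eq_self (F ζ) (fun _ => r)]
    congr 1 with u
    have h1 := absVandermonde_add_const a u r
    have h2 : (u + fun _ => r) = fun j => u j + r := rfl
    simp only [hF, h2, h1]
    congr 1
    exact Finset.prod_congr rfl fun j _ => by push_cast; ring_nf
  -- The complex derivative is the derivative along the real direction, where nothing changes.
  have hzero : ∀ ζ, deriv (fun ζ => ∫ u, F ζ u) ζ = 0 := by
    intro ζ
    have h1 : HasDerivAt (fun r : ℝ => ζ + (r : ℂ)) 1 0 :=
      (Complex.ofRealCLM.hasDerivAt (x := 0)).const_add ζ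
    have h2 := (show HasDerivAt (fun ζ => ∫ u, F ζ u) (deriv (fun ζ => ∫ u, F ζ u) ζ)
      (ζ + ((0 : ℝ) : ℂ)) by
        simpa using (hderiv ζ).differentiableAt.hasDerivAt).comp (0 : ℝ) h1
    have h3 : ((fun ζ => ∫ u, F ζ u) ∘ fun r : ℝ => ζ + (r : ℂ)) = fun _ => ∫ u, F ζ u := by
      funext r
      exact hreal ζ r
    rw [h3] at h2
    simpa using h2.unique (hasDerivAt_const _ _)
  have := is_const_of_deriv_eq_zero (fun ζ => (hderiv ζ).differentiableAt) hzero ζ 0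
  simpa [hF] using this

/-! ### Symmetrization over the ordered chamber -/

theorem measurableSet_nested (n : ℕ) : MeasurableSet (nested n) := by
  have h : nested n = ⋂ i, ⋂ j, {t : Fin n → ℝ | i < j → t j < t i} := by
    ext t
    simp only [nested, StrictAnti, Set.mem_iInter, Set.mem_ofPred_eq]
  rw [h]
  refine MeasurableSet.iInter fun i => MeasurableSet.iInter fun j => ?_
  by_cases hij : i < j
  · simpa [hij] using measurableSet_lt (measurable_pi_apply j) (measurable_pi_apply i)
  · simp [hij]

/-- The tuples with `t_i = t_j` lie on a hyperplane. -/
theorem ae_injective (n : ℕ) : ∀ᵐ t : Fin n → ℝ, Function.Injective t := by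
  have h : ∀ i j : Fin n, i ≠ j → ∀ᵐ t : Fin n → ℝ, t i ≠ t j := by
    intro i j hij
    have hne : LinearMap.ker ((LinearMap.proj i : (Fin n → ℝ) →ₗ[ℝ] ℝ) - LinearMap.proj j) ≠ ⊤ := by
      intro h
      have h1 : Pi.single i (1 : ℝ) ∈
          LinearMap.ker ((LinearMap.proj i : (Fin n → ℝ) →ₗ[ℝ] ℝ) - LinearMap.proj j) := by
        rw [h]; trivial
      simp [LinearMap.mem_ker, hij.symm] at h1
    have h0 := Measure.addHaar_submodule (volume : Measure (Fin n → ℝ)) _ hne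
    filter_upwards [measure_eq_zero_iff_ae_notMem.1 h0] with t ht hteq
    exact ht (by simp [LinearMap.mem_ker, hteq])
  have h2 : ∀ᵐ t : Fin n → ℝ, ∀ i j : Fin n, i ≠ j → t i ≠ t j := by
    rw [ae_all_iff]; intro i
    rw [ae_all_iff]; intro j
    by_cases hij : i = j
    · simp [hij]
    · filter_upwards [h i j hij] with t ht _ using ht
  filter_upwards [h2] with t ht i j hij
  by_contra hne
  exact ht i j hne hij

theorem exists_perm_strictAnti {n : ℕ} {t : Fin n → ℝ} (ht : Function.Injective t) :
    ∃ σ : Equiv.Perm (Fin n), StrictAnti (t ∘ σ) := by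
  have h1 : StrictMono (t ∘ Tuple.sort t) :=
    (Tuple.monotone_sort t).strictMono_of_injective (ht.comp (Tuple.sort t).injective)
  refine ⟨Fin.revPerm.trans (Tuple.sort t), fun i j hij => h1 ?_⟩
  simpa using hij

theorem perm_eq_of_strictAnti {n : ℕ} {t : Fin n → ℝ} {σ τ : Equiv.Perm (Fin n)}
    (hσ : StrictAnti (t ∘ σ)) (hτ : StrictAnti (t ∘ τ)) : σ = τ := by
  have h1 : Function.Injective t := by
    have := hσ.injective.comp σ.symm.injective
    simpa [Function.comp_assoc] using this
  have h2 : (t ∘ σ) = t ∘ τ := by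
    have h3 : Monotone ((fun i => -t i) ∘ σ) := fun i j hij => neg_le_neg (hσ.antitone hij)
    have h4 : Monotone ((fun i => -t i) ∘ τ) := fun i j hij => neg_le_neg (hτ.antitone hij)
    funext i
    simpa using congrFun (Tuple.unique_monotone h3 h4) i
  ext i
  exact congrArg Fin.val (h1 (congrFun h2 i))

/-- The integral of a symmetric function is `n!` times its integral over the decreasing tuples. -/
theorem integral_eq_factorial_mul_setIntegral_nested {n : ℕ} {F : (Fin n → ℝ) → ℂ}
    (hF : Integrable F) (hs : ∀ (σ : Equiv.Perm (Fin n)) t, F (t ∘ σ) = F t) :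
    ∫ t, F t = (n ! : ℂ) * ∫ t in nested n, F t := by
  let S : Equiv.Perm (Fin n) → Set (Fin n → ℝ) := fun σ => (fun t => t ∘ σ) ⁻¹' nested n
  have hmp : ∀ σ : Equiv.Perm (Fin n), MeasurePreserving (fun t : Fin n → ℝ => t ∘ σ) := by
    intro σ
    have h1 : (fun t : Fin n → ℝ => t ∘ σ) =
        MeasurableEquiv.piCongrLeft (fun _ : Fin n => ℝ) σ⁻¹ := by
      funext t i
      have := Equiv.piCongrLeft_apply_apply (P := fun _ : Fin n => ℝ) σ⁻¹ t (σ i)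
      simpa [MeasurableEquiv.coe_piCongrLeft] using this.symm
    rw [h1]
    exact volume_measurePreserving_piCongrLeft (fun _ : Fin n => ℝ) σ⁻¹
  have hemb : ∀ σ : Equiv.Perm (Fin n), MeasurableEmbedding (fun t : Fin n → ℝ => t ∘ σ) :=
    fun σ => (MeasurableEquiv.arrowCongr' σ.symm (MeasurableEquiv.refl ℝ)).measurableEmbedding
  have hS : ∀ σ, MeasurableSet (S σ) := fun σ => (hmp σ).measurable (measurableSet_nested n)
  have hdis : Pairwise (Function.onFun Disjoint S) := fun σ τ hστ =>
    Set.disjoint_left.2 fun t h1 h2 => hστ (perm_eq_of_strictAnti h1 h2)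
  have hcov : (⋃ σ, S σ) =ᵐ[volume] Set.univ := by
    refine eventuallyEq_univ.2 ?_
    filter_upwards [ae_injective n] with t ht
    exact Set.mem_iUnion.2 (exists_perm_strictAnti ht)
  rw [← setIntegral_univ, ← setIntegral_congr_set hcov,
    integral_iUnion_fintype hS hdis fun _ => hF.integrableOn]
  have hEq : ∀ σ, ∫ t in S σ, F t = ∫ t in nested n, F t := by
    intro σ
    rw [← (hmp σ).setIntegral_preimage_emb (hemb σ) F (nested n)]
    simp only [hs]
    rfl
  simp [hEq, Fintype.card_perm]

/-! ### The Kontsevich integral over the whole space -/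

/-- The exponential `e^{v³/3 - xv}` on the contour `v = c + i t`. -/
noncomputable def cubicExp (c x t : ℝ) : ℂ :=
  Complex.exp (vert c t ^ 3 / 3 - (x : ℂ) * vert c t)

theorem continuous_cubicExp (c x : ℝ) : Continuous (cubicExp c x) := by
  unfold cubicExp vert
  fun_prop

/-- On the contour the cubic exponential decays like a Gaussian of width governed by `c`. -/
theorem re_cubic (c x t : ℝ) :
    (vert c t ^ 3 / 3 - (x : ℂ) * vert c t).re = (c ^ 3 / 3 - x * c) - c * t ^ 2 := by
  have h : vert c t ^ 3 / 3 - (x : ℂ) * vert c t =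
      ((c ^ 3 / 3 - x * c - c * t ^ 2 : ℝ) : ℂ) +
        ((c ^ 2 * t - t ^ 3 / 3 - x * t : ℝ) : ℂ) * Complex.I := by
    simp only [vert]
    push_cast
    linear_combination (c * t ^ 2 + t ^ 3 / 3 * Complex.I : ℂ) * Complex.I_sq
  rw [h, Complex.add_re, Complex.ofReal_re, Complex.re_ofReal_mul, Complex.I_re, mul_zero, add_zero]

theorem norm_cubicExp (c x t : ℝ) :
    ‖cubicExp c x t‖ = Real.exp (c ^ 3 / 3 - x * c) * Real.exp (-c * t ^ 2) := by
  rw [cubicExp, Complex.norm_exp, re_cubic, ← Real.exp_add]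
  ring_nf

theorem integrable_prod_cubicExp {n : ℕ} {a c : ℝ} (ha : 0 ≤ a) (hc : 0 < c) (x : ℝ) :
    Integrable fun t : Fin n → ℝ => (∏ j, cubicExp c x (t j)) * (absVandermonde a t : ℂ) :=
  integrable_prod_mul_absVandermonde ha hc (continuous_cubicExp c x)
    fun t => (norm_cubicExp c x t).le

/-- The principal power of a positive multiple of `i`. -/
theorem ofReal_mul_I_cpow {r : ℝ} (hr : 0 < r) (a : ℝ) :
    ((r : ℂ) * Complex.I) ^ (a : ℂ) =
      ((r ^ a : ℝ) : ℂ) * Complex.exp (a * (Real.pi / 2 * Complex.I)) := by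
  rw [Complex.cpow_def_of_ne_zero (mul_ne_zero (by exact_mod_cast hr.ne') Complex.I_ne_zero),
    Complex.log_ofReal_mul hr Complex.I_ne_zero, Complex.log_I, Real.rpow_def_of_pos hr,
    Complex.ofReal_exp, ← Complex.exp_add]
  push_cast
  ring_nf

/-- On the nested contours the phases of the principal powers combine to one constant. -/
theorem kontsevichIntegrand_eq {n : ℕ} {β : ℝ} (c x : ℝ) {t : Fin n → ℝ} (ht : t ∈ nested n) :
    kontsevichIntegrand n β c x t =
      (Complex.I ^ n * Complex.exp ((4 / β : ℝ) * (Real.pi / 2 * Complex.I)) ^ (n * (n - 1) / 2)) *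
        ((∏ j, cubicExp c x (t j)) * (absVandermonde (4 / β) t : ℂ)) := by
  have h1 : ∏ k, ∏ l ∈ Finset.Ioi k, (vert c (t k) - vert c (t l)) ^ ((4 / β : ℝ) : ℂ) =
      (absVandermonde (4 / β) t : ℂ) *
        Complex.exp ((4 / β : ℝ) * (Real.pi / 2 * Complex.I)) ^ (n * (n - 1) / 2) := by
    rw [← prod_prod_Ioi_const, absVandermonde]
    push_cast only [Complex.ofReal_prod]
    simp only [← Finset.prod_mul_distrib]
    refine Finset.prod_congr rfl fun k _ => Finset.prod_congr rfl fun l hl => ?_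
    have hlt : 0 < t k - t l := sub_pos.2 (ht (Finset.mem_Ioi.1 hl))
    have h2 : vert c (t k) - vert c (t l) = ((t k - t l : ℝ) : ℂ) * Complex.I := by
      simp only [vert]
      push_cast
      ring
    rw [h2, ofReal_mul_I_cpow hlt, abs_of_pos hlt]
  rw [kontsevichIntegrand, h1, Finset.prod_mul_distrib]
  simp only [Finset.prod_const, Finset.card_univ, Fintype.card_fin, cubicExp]
  ring

theorem integrableOn_kontsevichIntegrand {n : ℕ} {β c : ℝ} (hβ : 0 ≤ β) (hc : 0 < c) (x : ℝ) :
    IntegrableOn (kontsevichIntegrand n β c x) (nested n) :=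
  (((integrable_prod_cubicExp (n := n) (a := 4 / β) (by positivity) hc x).const_mul
    (Complex.I ^ n * Complex.exp ((4 / β : ℝ) * (Real.pi / 2 * Complex.I)) ^ (n * (n - 1) / 2))
    ).integrableOn).congr_fun (fun _ ht => (kontsevichIntegrand_eq c x ht).symm)
    (measurableSet_nested n)

/-- For `n = β` even the total phase is `e^{iπ(β-1)} = -1`, which cancels the sign in the
definition of `K`. -/
theorem kontsevichK_eq {β : ℕ} (hβ : Even β) (hβ0 : 0 < β) {c : ℝ} (hc : 0 < c) (x : ℝ) :
    kontsevichK β (β : ℝ) c x = (1 / (2 * (Real.pi : ℂ)) ^ β) *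
      ∫ t : Fin β → ℝ, (∏ j, cubicExp c x (t j)) * (absVandermonde (4 / (β : ℝ)) t : ℂ) := by
  have hphase : Complex.exp ((4 / (β : ℝ) : ℝ) * (Real.pi / 2 * Complex.I)) ^ (β * (β - 1) / 2)
      = -1 := by
    obtain ⟨m, rfl⟩ := hβ
    have hm : 0 < m := by omega
    have hmC : (m : ℂ) ≠ 0 := by exact_mod_cast hm.ne'
    have h1 : (m + m) * (m + m - 1) / 2 = m * (2 * m - 1) := by
      rw [← two_mul, mul_assoc, Nat.mul_div_cancel_left _ two_pos]
    have h2 : ((2 * m - 1 : ℕ) : ℂ) = 2 * m - 1 := by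
      rw [Nat.cast_sub (by omega)]
      push_cast
      ring
    rw [h1, ← Complex.exp_nat_mul]
    push_cast
    rw [h2]
    have h3 : (m : ℂ) * (2 * m - 1) * (4 / (m + m) * (Real.pi / 2 * Complex.I)) =
        ((2 * m - 1 : ℤ) : ℂ) * (Real.pi * Complex.I) := by
      push_cast
      field_simp
      ring
    rw [h3, Complex.exp_int_mul, Complex.exp_pi_mul_I]
    exact Odd.neg_one_zpow ⟨m - 1, by ring⟩
  rw [integral_eq_factorial_mul_setIntegral_nested
    (integrable_prod_cubicExp (by positivity) hc x) fun σ t => by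
      rw [absVandermonde_comp_perm]
      congr 1
      exact Equiv.prod_comp σ fun j => cubicExp c x (t j),
    kontsevichK, setIntegral_congr_fun (measurableSet_nested β)
      fun t ht => kontsevichIntegrand_eq c x ht, integral_const_mul, hphase, mul_pow]
  have hI : Complex.I ^ β ≠ 0 := pow_ne_zero _ Complex.I_ne_zero
  have hpi : (2 * (Real.pi : ℂ)) ^ β ≠ 0 := by simp [Real.pi_ne_zero]
  field_simp

/-! ### Expansion of the exponent at the double saddle point -/

/-- On the closed right half-plane the Taylor remainders of `log (1 + z)` are bounded globally,
not only for `‖z‖ < 1`. -/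
theorem norm_log_sub_logTaylor_le_of_re_nonneg (n : ℕ) {z : ℂ} (hz : 0 ≤ z.re) :
    ‖Complex.log (1 + z) - Complex.logTaylor (n + 1) z‖ ≤ ‖z‖ ^ (n + 1) := by
  have hseg : ∀ w ∈ segment ℝ 0 z, 0 ≤ w.re ∧ ‖w‖ ≤ ‖z‖ := by
    rintro w ⟨p, q, hp, hq, hpq, rfl⟩
    have hq1 : q ≤ 1 := by linarith
    constructor
    · simpa using mul_nonneg hq hz
    · simpa [abs_of_nonneg hq] using mul_le_of_le_one_left (norm_nonneg z) hq1
  have h := (convex_segment (𝕜 := ℝ) (0 : ℂ) z).norm_image_sub_le_of_norm_hasDerivWithin_le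
    (f := fun w => Complex.log (1 + w) - Complex.logTaylor (n + 1) w)
    (f' := fun w => (-w) ^ n * (1 + w)⁻¹) (C := ‖z‖ ^ n)
    (fun w hw => (Complex.hasDerivAt_log_sub_logTaylor n (Or.inl (by
      have := (hseg w hw).1
      simp only [Complex.add_re, Complex.one_re]
      linarith))).hasDerivWithinAt)
    (fun w hw => by
      obtain ⟨h1, h2⟩ := hseg w hw
      have h3 : 1 ≤ ‖1 + w‖ := by
        refine le_trans ?_ (Complex.re_le_norm _)
        simp only [Complex.add_re, Complex.one_re]
        linarith
      rw [norm_mul, norm_pow, norm_neg, norm_inv]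
      calc ‖w‖ ^ n * ‖1 + w‖⁻¹ ≤ ‖z‖ ^ n * 1 := by
            gcongr
            exact inv_le_one_of_one_le₀ h3
        _ = ‖z‖ ^ n := mul_one _)
    (left_mem_segment ℝ 0 z) (right_mem_segment ℝ 0 z)
  simpa [Complex.logTaylor_at_zero, pow_succ] using h

theorem norm_log_one_add_le_of_re_nonneg {z : ℂ} (hz : 0 ≤ z.re) :
    ‖Complex.log (1 + z)‖ ≤ ‖z‖ := by
  simpa [Complex.logTaylor_succ, Complex.logTaylor_zero] using
    norm_log_sub_logTaylor_le_of_re_nonneg 0 hz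

theorem norm_exp_sub_exp_le {m : ℝ} {A B : ℂ} (hA : A.re ≤ m) (hB : B.re ≤ m) :
    ‖Complex.exp A - Complex.exp B‖ ≤ Real.exp m * ‖A - B‖ := by
  refine (convex_halfSpace_re_le m).norm_image_sub_le_of_norm_hasDerivWithin_le
    (fun w _ => (Complex.hasDerivAt_exp w).hasDerivWithinAt) (fun w hw => ?_) hB hA
  rw [Complex.norm_exp]
  exact Real.exp_le_exp.2 hw

/-- The exponent of the integrand of `R_{N,β}(1 + xε²/2)` with `ε = N^{-1/3}`, in the variable
`v = c + i t` given by `u = i/2 - i ε v/2`, after removal of its value at the saddle point and of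
the term `x/ε`. -/
noncomputable def scaledExponent (N : ℕ) (ε c x t : ℝ) : ℂ :=
  -vert c t / ε ^ 2 + vert c t ^ 2 / (2 * ε) - x / ε +
    (N - 1) * Complex.log (1 + ε * (vert c t + x * ε))

/-- With `N ε³ = 1` the cubic Taylor polynomial of the logarithm cancels all negative powers of `ε`.
Here `Complex.logTaylor 4` is the Taylor polynomial of degree `3`. -/
theorem scaledExponent_sub_cubic {N : ℕ} {ε c x : ℝ} (hε : 0 < ε) (hN : N * ε ^ 3 = 1) (t : ℝ) :
    scaledExponent N ε c x t - (vert c t ^ 3 / 3 - x * vert c t) =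
      N * (Complex.log (1 + ε * (vert c t + x * ε)) -
          Complex.logTaylor 4 (ε * (vert c t + x * ε))) -
        Complex.log (1 + ε * (vert c t + x * ε)) +
        ε * (-x ^ 2 / 2 + x * ((vert c t + x * ε) ^ 2 + (vert c t + x * ε) * vert c t
          + vert c t ^ 2) / 3) := by
  have hεC : (ε : ℂ) ≠ 0 := by exact_mod_cast hε.ne'
  have hNC : (N : ℂ) = 1 / (ε : ℂ) ^ 3 := by
    rw [eq_div_iff (pow_ne_zero _ hεC)]
    exact_mod_cast hN
  simp only [scaledExponent, Complex.logTaylor, Finset.sum_range_succ, Finset.sum_range_zero]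
  rw [hNC]
  push_cast
  field_simp
  ring

theorem re_vert (c t : ℝ) : (vert c t).re = c := by simp [vert]

theorem norm_vert_add_le (c x t : ℝ) {ε : ℝ} (hε : 0 < ε) (hε1 : ε ≤ 1) :
    ‖vert c t + x * ε‖ ≤ (1 + |c| + |x|) * (1 + |t|) := by
  have h1 : ‖vert c t + x * ε‖ ≤ |c| + |t| + |x| * ε := by
    refine (norm_add_le _ _).trans (add_le_add ((norm_add_le _ _).trans ?_) ?_)
    · simp
    · simp [abs_of_pos hε]
  have h2 : |x| * ε ≤ |x| := mul_le_of_le_one_right (abs_nonneg x) hε1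
  nlinarith [abs_nonneg c, abs_nonneg t, abs_nonneg x, mul_nonneg (abs_nonneg c) (abs_nonneg t),
    mul_nonneg (abs_nonneg x) (abs_nonneg t)]

/-- The bound holds for all `t`, not only for `ε |t|` small, since `1 + ε(v + xε)` stays in the
half-plane where the Taylor remainder of the logarithm is controlled. -/
theorem norm_scaledExponent_sub_cubic_le {N : ℕ} {ε c x : ℝ} (hε : 0 < ε) (hε1 : ε ≤ 1)
    (hN : N * ε ^ 3 = 1) (hpos : 0 ≤ c + x * ε) (t : ℝ) :
    ‖scaledExponent N ε c x t - (vert c t ^ 3 / 3 - x * vert c t)‖ ≤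
      4 * (1 + |c| + |x|) ^ 4 * ε * (1 + |t|) ^ 4 := by
  set B := (1 + |c| + |x|) * (1 + |t|) with hB
  set v := vert c t with hv
  have hq : ‖v + x * ε‖ ≤ B := norm_vert_add_le c x t hε hε1
  have hv' : ‖v‖ ≤ B := by simpa using norm_vert_add_le c 0 t hε hε1 |>.trans (by
    rw [hB, abs_zero]
    gcongr
    exact abs_nonneg x)
  have hAB : 1 + |c| + |x| ≤ B :=
    le_mul_of_one_le_right (by positivity) (le_add_of_nonneg_right (abs_nonneg t))
  have hxB : |x| ≤ B := by linarith [abs_nonneg c]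
  have hB1 : 1 ≤ B := by linarith [abs_nonneg c, abs_nonneg x]
  have hB0 : 0 ≤ B := by linarith
  have hz : 0 ≤ ((ε : ℂ) * (v + x * ε)).re := by
    rw [Complex.re_ofReal_mul, Complex.add_re, hv, re_vert, ← Complex.ofReal_mul,
      Complex.ofReal_re]
    exact mul_nonneg hε.le hpos
  have hzn : ‖(ε : ℂ) * (v + x * ε)‖ = ε * ‖v + x * ε‖ := by
    rw [norm_mul, Complex.norm_of_nonneg hε.le]
  have h1 := norm_log_sub_logTaylor_le_of_re_nonneg 3 hz
  have h2 := norm_log_one_add_le_of_re_nonneg hz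
  rw [hzn] at h1 h2
  rw [scaledExponent_sub_cubic hε hN]
  have e1 : ‖(N : ℂ) * (Complex.log (1 + ε * (v + x * ε)) -
      Complex.logTaylor 4 (ε * (v + x * ε)))‖ ≤ ε * B ^ 4 := by
    rw [norm_mul, Complex.norm_natCast]
    calc (N : ℝ) * _ ≤ N * (ε * B) ^ 4 := by
          gcongr
          exact h1.trans (by gcongr)
      _ = (N * ε ^ 3) * (ε * B ^ 4) := by ring
      _ = ε * B ^ 4 := by rw [hN, one_mul]
  have e2 : ‖Complex.log (1 + ε * (v + x * ε))‖ ≤ ε * B ^ 4 := by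
    refine h2.trans (mul_le_mul_of_nonneg_left (hq.trans ?_) hε.le)
    exact le_self_pow₀ hB1 (by norm_num)
  have e3 : ‖(-(x : ℂ) ^ 2 / 2 + x * ((v + x * ε) ^ 2 + (v + x * ε) * v + v ^ 2) / 3)‖
      ≤ 2 * B ^ 4 := by
    have e4 : ‖(v + x * ε) ^ 2 + (v + x * ε) * v + v ^ 2‖ ≤ 3 * B ^ 2 := by
      refine norm_add₃_le.trans ?_
      rw [norm_pow, norm_mul, norm_pow]
      have a1 : ‖v + x * ε‖ ^ 2 ≤ B ^ 2 := by gcongr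
      have a2 : ‖v + x * ε‖ * ‖v‖ ≤ B * B := by gcongr
      have a3 : ‖v‖ ^ 2 ≤ B ^ 2 := by gcongr
      linarith
    have e5 : ‖(x : ℂ)‖ ≤ B := by simpa using hxB
    refine (norm_add_le _ _).trans ?_
    rw [norm_div, norm_neg, norm_pow, norm_div, norm_mul, Complex.norm_ofNat, Complex.norm_ofNat]
    have a1 : ‖(x : ℂ)‖ ^ 2 ≤ B ^ 2 := by gcongr
    have a2 : ‖(x : ℂ)‖ * ‖(v + x * ε) ^ 2 + (v + x * ε) * v + v ^ 2‖ ≤ B * (3 * B ^ 2) := by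
      gcongr
    have a3 : B ^ 2 ≤ B ^ 4 := pow_le_pow_right₀ hB1 (by norm_num)
    have a4 : B ^ 3 ≤ B ^ 4 := pow_le_pow_right₀ hB1 (by norm_num)
    have a5 : 0 ≤ B ^ 4 := by positivity
    linarith
  have e6 : ‖(ε : ℂ) * (-(x : ℂ) ^ 2 / 2 + x * ((v + x * ε) ^ 2 + (v + x * ε) * v + v ^ 2) / 3)‖
      ≤ ε * (2 * B ^ 4) := by
    rw [norm_mul, Complex.norm_of_nonneg hε.le]
    gcongr
  calc _ ≤ ε * B ^ 4 + ε * B ^ 4 + ε * (2 * B ^ 4) :=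
        (norm_add_le _ _).trans (add_le_add ((norm_sub_le _ _).trans (add_le_add e1 e2)) e6)
    _ = _ := by rw [hB]; ring

/-- Along the contour the Gaussian factor `-t²/(2ε)` beats the growth of the logarithm, thanks to
`Re (1 + ε(v + xε)) > 1`; this is where `c > 0` is used. -/
theorem re_scaledExponent_le {N : ℕ} {ε c x : ℝ} (hc : 0 < c) (hε : 0 < ε)
    (hN : N * ε ^ 3 = 1) (hx : |x| * ε ≤ c / 2) (hcε : c * ε ≤ 1 / 4) (t : ℝ) :
    (scaledExponent N ε c x t).re ≤ (scaledExponent N ε c x 0).re - c / 4 * t ^ 2 := by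
  set a := 1 + ε * (c + x * ε) with ha
  have hx' : -(c / 2) ≤ x * ε ∧ x * ε ≤ c / 2 := abs_le.1 (by rwa [abs_mul, abs_of_pos hε])
  have ha1 : 1 + c * ε / 2 ≤ a := by nlinarith
  have ha2 : a ≤ 1 + 3 / 8 := by nlinarith
  have hcε0 : 0 < c * ε := mul_pos hc hε
  have ha0 : 0 < a := by linarith
  have hre : ∀ s : ℝ, (scaledExponent N ε c x s).re =
      -c / ε ^ 2 + (c ^ 2 - s ^ 2) / (2 * ε) - x / ε +
        (N - 1) * (Real.log (a ^ 2 + ε ^ 2 * s ^ 2) / 2) := by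
    intro s
    have h1 : (1 + ε * (vert c s + x * ε) : ℂ) = (a : ℂ) + ((ε * s : ℝ) : ℂ) * Complex.I := by
      simp only [ha, vert]
      push_cast
      ring
    have h2 : ‖(1 + ε * (vert c s + x * ε) : ℂ)‖ = Real.sqrt (a ^ 2 + ε ^ 2 * s ^ 2) := by
      rw [h1, Complex.norm_add_mul_I, mul_pow]
    have h3 : (-vert c s / ε ^ 2 + vert c s ^ 2 / (2 * ε) - x / ε : ℂ) =
        ((-c / ε ^ 2 + (c ^ 2 - s ^ 2) / (2 * ε) - x / ε : ℝ) : ℂ) +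
          ((-s / ε ^ 2 + c * s / ε : ℝ) : ℂ) * Complex.I := by
      simp only [vert]
      push_cast
      linear_combination ((s : ℂ) ^ 2 / (2 * ε)) * Complex.I_sq
    have h4 : ((N : ℂ) - 1) = ((N - 1 : ℝ) : ℂ) := by push_cast; rfl
    rw [scaledExponent, h3, h4, Complex.add_re, Complex.re_ofReal_mul, Complex.log_re, h2,
      Real.log_sqrt (by positivity), Complex.add_re, Complex.ofReal_re, Complex.re_ofReal_mul,
      Complex.I_re, mul_zero, add_zero]
  have hN1 : (1 : ℝ) ≤ N := by
    have : N ≠ 0 := by rintro rfl; simp at hN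
    exact_mod_cast Nat.one_le_iff_ne_zero.2 this
  have hlog : Real.log (a ^ 2 + ε ^ 2 * t ^ 2) ≤ Real.log (a ^ 2) + ε ^ 2 * t ^ 2 / a ^ 2 := by
    have h1 : a ^ 2 + ε ^ 2 * t ^ 2 = a ^ 2 * (1 + ε ^ 2 * t ^ 2 / a ^ 2) := by field_simp
    rw [h1, Real.log_mul (by positivity) (by positivity)]
    have := Real.log_le_sub_one_of_pos (show 0 < 1 + ε ^ 2 * t ^ 2 / a ^ 2 by positivity)
    linarith
  have hNt : ((N : ℝ) - 1) * (ε ^ 2 * t ^ 2 / a ^ 2 / 2) ≤ t ^ 2 / (2 * ε) * (1 / a ^ 2) := by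
    calc ((N : ℝ) - 1) * (ε ^ 2 * t ^ 2 / a ^ 2 / 2) ≤ N * (ε ^ 2 * t ^ 2 / a ^ 2 / 2) := by
          gcongr
          linarith
      _ = (N * ε ^ 3) * (t ^ 2 / (2 * ε) * (1 / a ^ 2)) := by field_simp
      _ = _ := by rw [hN, one_mul]
  -- `a ≈ 1 + cε` makes `1 - 1/a²` of order `ε`, which cancels the `1/ε` in `t²/(2ε)`.
  have hgap : c * ε / 2 ≤ 1 - 1 / a ^ 2 := by
    have h1 : 1 - 1 / a ^ 2 = (a ^ 2 - 1) / a ^ 2 := by field_simp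
    rw [h1, le_div_iff₀ (by positivity)]
    have h2 : a ^ 2 ≤ 2 := by nlinarith
    nlinarith
  have hmain : c / 4 * t ^ 2 ≤ t ^ 2 / (2 * ε) * (1 - 1 / a ^ 2) := by
    calc c / 4 * t ^ 2 = t ^ 2 / (2 * ε) * (c * ε / 2) := by field_simp; ring
      _ ≤ _ := by gcongr
  rw [hre t, hre 0]
  have hs : (c ^ 2 - t ^ 2) / (2 * ε) = (c ^ 2 - 0 ^ 2) / (2 * ε) - t ^ 2 / (2 * ε) := by ring
  have h5 := mul_le_mul_of_nonneg_left (div_le_div_of_nonneg_right hlog zero_le_two)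
    (sub_nonneg.2 hN1)
  have h6 : a ^ 2 + ε ^ 2 * 0 ^ 2 = a ^ 2 := by ring
  rw [hs, h6]
  have h7 : ((N : ℝ) - 1) * ((Real.log (a ^ 2) + ε ^ 2 * t ^ 2 / a ^ 2) / 2) =
      (N - 1) * (Real.log (a ^ 2) / 2) + (N - 1) * (ε ^ 2 * t ^ 2 / a ^ 2 / 2) := by ring
  linarith

/-! ### Convergence of the rescaled integral with rate -/

/-- The rescaled one-variable weight, the exponential of `scaledExponent` with the logarithm
written as a power. -/
noncomputable def scaledWeight (N : ℕ) (ε c x t : ℝ) : ℂ :=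
  Complex.exp (-vert c t / ε ^ 2 + vert c t ^ 2 / (2 * ε) - x / ε) *
    (1 + ε * (vert c t + x * ε)) ^ (N - 1)

theorem continuous_scaledWeight (N : ℕ) (ε c x : ℝ) : Continuous (scaledWeight N ε c x) := by
  unfold scaledWeight vert
  fun_prop

theorem scaledWeight_eq_exp {N : ℕ} (hN : 1 ≤ N) {ε c x t : ℝ}
    (h : (1 + ε * (vert c t + x * ε) : ℂ) ≠ 0) :
    scaledWeight N ε c x t = Complex.exp (scaledExponent N ε c x t) := by
  have h1 : ((N : ℂ) - 1) = ((N - 1 : ℕ) : ℂ) := by rw [Nat.cast_sub hN, Nat.cast_one]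
  rw [scaledWeight, scaledExponent, Complex.exp_add, h1, Complex.exp_nat_mul, Complex.exp_log h]

/-- Gaussian domination of both weights and of their difference, the latter with a factor `ε`. -/
theorem exists_scaledWeight_bounds {c : ℝ} (hc : 0 < c) (x : ℝ) :
    ∃ C b ε₀ : ℝ, 0 < b ∧ 0 < ε₀ ∧ ∀ (N : ℕ) (ε : ℝ), 0 < ε → ε ≤ ε₀ → N * ε ^ 3 = 1 → ∀ t,
      ‖scaledWeight N ε c x t‖ ≤ C * Real.exp (-b * t ^ 2) ∧
      ‖cubicExp c x t‖ ≤ C * Real.exp (-b * t ^ 2) ∧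
      ‖scaledWeight N ε c x t - cubicExp c x t‖ ≤ ε * (C * Real.exp (-b * t ^ 2)) := by
  set D := 4 * (1 + |c| + |x|) ^ 4 with hD
  set m := c ^ 3 / 3 - x * c + D with hm
  have hD0 : 0 ≤ D := by positivity
  -- `m` bounds both real exponents at `t = 0`. The second summand of the constant comes from
  -- absorbing `(1 + |t|)⁴` into the Gaussian, and `ε₀` makes `|x| ε ≤ c/2` and `c ε ≤ 1/4`.
  refine ⟨Real.exp m + Real.exp m * (D * Real.exp ((4 : ℕ) ^ 2 / (2 * (c / 4)))), c / 4 / 2,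
    min 1 (min (c / 2 / (1 + |x|)) (1 / 4 / c)), by positivity, by positivity, ?_⟩
  intro N ε hε hle hN t
  have hε1 : ε ≤ 1 := hle.trans (min_le_left _ _)
  have hε2 : ε ≤ c / 2 / (1 + |x|) := hle.trans ((min_le_right _ _).trans (min_le_left _ _))
  have hε3 : ε ≤ 1 / 4 / c := hle.trans ((min_le_right _ _).trans (min_le_right _ _))
  have hx : |x| * ε ≤ c / 2 := by
    rw [le_div_iff₀ (by positivity)] at hε2
    nlinarith
  have hcε : c * ε ≤ 1 / 4 := by
    rw [le_div_iff₀ hc] at hε3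
    linarith
  have hpos : 0 ≤ c + x * ε := by
    have : |x * ε| ≤ c / 2 := by rwa [abs_mul, abs_of_pos hε]
    linarith [(abs_le.1 this).1]
  have hN1 : 1 ≤ N := by
    have : N ≠ 0 := by rintro rfl; simp at hN
    omega
  have hne : ∀ s, (1 + ε * (vert c s + x * ε) : ℂ) ≠ 0 := by
    intro s h
    have h1 := congrArg Complex.re h
    rw [Complex.add_re, Complex.re_ofReal_mul, Complex.add_re, re_vert, ← Complex.ofReal_mul,
      Complex.ofReal_re] at h1
    simp only [Complex.one_re, Complex.zero_re] at h1
    nlinarith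
  have hdiff := norm_scaledExponent_sub_cubic_le hε hε1 hN hpos
  have h0 : (scaledExponent N ε c x 0).re ≤ m := by
    have h1 := (Complex.re_le_norm _).trans (hdiff 0)
    rw [Complex.sub_re, re_cubic, zero_pow two_ne_zero, mul_zero, sub_zero] at h1
    have h2 : 4 * (1 + |c| + |x|) ^ 4 * ε * (1 + |(0 : ℝ)|) ^ 4 ≤ D := by
      rw [abs_zero, add_zero, one_pow, mul_one]
      exact mul_le_of_le_one_right hD0 hε1
    have h3 := h1.trans h2
    rw [hm]
    linarith
  have hreS : (scaledExponent N ε c x t).re ≤ m - c / 4 * t ^ 2 :=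
    (re_scaledExponent_le hc hε hN hx hcε t).trans (by linarith)
  have hreC : (vert c t ^ 3 / 3 - (x : ℂ) * vert c t).re ≤ m - c / 4 * t ^ 2 := by
    rw [re_cubic, hm]
    nlinarith [sq_nonneg t, mul_nonneg hc.le (sq_nonneg t)]
  have hexp : Real.exp (m - c / 4 * t ^ 2) = Real.exp m * Real.exp (-(c / 4) * t ^ 2) := by
    rw [← Real.exp_add]
    ring_nf
  have hweak : Real.exp (m - c / 4 * t ^ 2) ≤
      (Real.exp m + Real.exp m * (D * Real.exp ((4 : ℕ) ^ 2 / (2 * (c / 4))))) *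
        Real.exp (-(c / 4 / 2) * t ^ 2) := by
    rw [hexp]
    have h1 : Real.exp (-(c / 4) * t ^ 2) ≤ Real.exp (-(c / 4 / 2) * t ^ 2) := by
      refine Real.exp_le_exp.2 ?_
      nlinarith [mul_nonneg hc.le (sq_nonneg t)]
    refine mul_le_mul ?_ h1 (Real.exp_pos _).le (by positivity)
    exact le_add_of_nonneg_right (by positivity)
  refine ⟨?_, ?_, ?_⟩
  · rw [scaledWeight_eq_exp hN1 (hne t), Complex.norm_exp]
    exact (Real.exp_le_exp.2 hreS).trans hweak
  · rw [cubicExp, Complex.norm_exp]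
    exact (Real.exp_le_exp.2 hreC).trans hweak
  · rw [scaledWeight_eq_exp hN1 (hne t), cubicExp]
    refine (norm_exp_sub_exp_le hreS hreC).trans ?_
    have hp := one_add_abs_pow_mul_exp_neg_le (show 0 < c / 4 by positivity) 4 t
    calc Real.exp (m - c / 4 * t ^ 2) * _
        ≤ (Real.exp m * Real.exp (-(c / 4) * t ^ 2)) * (D * ε * (1 + |t|) ^ 4) := by
          rw [hexp]
          exact mul_le_mul_of_nonneg_left (hdiff t) (by positivity)
      _ = ε * (Real.exp m * D * ((1 + |t|) ^ 4 * Real.exp (-(c / 4) * t ^ 2))) := by ring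
      _ ≤ ε * (Real.exp m * D * (Real.exp ((4 : ℕ) ^ 2 / (2 * (c / 4))) *
            Real.exp (-(c / 4 / 2) * t ^ 2))) := by gcongr
      _ ≤ _ := by
          refine mul_le_mul_of_nonneg_left ?_ hε.le
          have : 0 ≤ Real.exp m * Real.exp (-(c / 4 / 2) * t ^ 2) := by positivity
          linarith

theorem norm_prod_sub_prod_le {ι : Type*} (s : Finset ι) {A B : ι → ℂ} {M : ι → ℝ} {δ : ℝ}
    (hA : ∀ i, ‖A i‖ ≤ M i) (hB : ∀ i, ‖B i‖ ≤ M i) (hAB : ∀ i, ‖A i - B i‖ ≤ δ * M i) :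
    ‖∏ i ∈ s, A i - ∏ i ∈ s, B i‖ ≤ s.card * δ * ∏ i ∈ s, M i := by
  classical
  have hM : ∀ i, 0 ≤ M i := fun i => (norm_nonneg _).trans (hA i)
  induction s using Finset.induction_on with
  | empty => simp
  | insert i s hi ih =>
    have hBs : ‖∏ j ∈ s, B j‖ ≤ ∏ j ∈ s, M j := by
      rw [norm_prod]
      exact Finset.prod_le_prod (fun _ _ => norm_nonneg _) fun j _ => hB j
    rw [Finset.prod_insert hi, Finset.prod_insert hi, Finset.prod_insert hi,
      Finset.card_insert_of_notMem hi]
    calc _ = ‖A i * (∏ j ∈ s, A j - ∏ j ∈ s, B j) + (A i - B i) * ∏ j ∈ s, B j‖ := by ring_nf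
      _ ≤ M i * (s.card * δ * ∏ j ∈ s, M j) + (δ * M i) * ∏ j ∈ s, M j := by
        refine (norm_add_le _ _).trans ?_
        rw [norm_mul, norm_mul]
        exact add_le_add (mul_le_mul (hA i) ih (norm_nonneg _) (hM i))
          (mul_le_mul (hAB i) hBs (norm_nonneg _) ((norm_nonneg _).trans (hAB i)))
      _ = _ := by push_cast; ring

theorem exists_norm_integral_sub_le {n : ℕ} {a c : ℝ} (ha : 0 ≤ a) (hc : 0 < c) (x : ℝ) :
    ∃ K ε₀ : ℝ, 0 < ε₀ ∧ ∀ (N : ℕ) (ε : ℝ), 0 < ε → ε ≤ ε₀ → N * ε ^ 3 = 1 →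
      ‖(∫ t : Fin n → ℝ, (∏ j, scaledWeight N ε c x (t j)) * (absVandermonde a t : ℂ)) -
        ∫ t : Fin n → ℝ, (∏ j, cubicExp c x (t j)) * (absVandermonde a t : ℂ)‖ ≤ K * ε := by
  obtain ⟨C, b, ε₀, hb, hε₀, h⟩ := exists_scaledWeight_bounds hc x
  refine ⟨n * C ^ n * ∫ t : Fin n → ℝ, (∏ j, Real.exp (-b * t j ^ 2)) * absVandermonde a t,
    ε₀, hε₀, fun N ε hε hle hN => ?_⟩
  have hbd := h N ε hε hle hN
  rw [← integral_sub
    (integrable_prod_mul_absVandermonde ha hb (continuous_scaledWeight N ε c x)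
      fun t => (hbd t).1) (integrable_prod_cubicExp ha hc x)]
  calc _ ≤ ∫ t : Fin n → ℝ, (n * C ^ n * ε) *
        ((∏ j, Real.exp (-b * t j ^ 2)) * absVandermonde a t) := by
        refine norm_integral_le_of_norm_le
          ((integrable_prod_exp_mul_absVandermonde ha hb).const_mul _)
          (Eventually.of_forall fun t => ?_)
        have hV := absVandermonde_nonneg a t
        rw [← sub_mul, norm_mul, Complex.norm_of_nonneg hV, ← mul_assoc]
        refine mul_le_mul_of_nonneg_right ?_ hV
        refine (norm_prod_sub_prod_le Finset.univ (fun j => (hbd (t j)).1)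
          (fun j => (hbd (t j)).2.1) fun j => (hbd (t j)).2.2).trans (le_of_eq ?_)
        rw [Finset.prod_mul_distrib]
        simp only [Finset.card_univ, Fintype.card_fin, Finset.prod_const]
        ring
    _ = _ := by rw [integral_const_mul]; ring

/-! ### The Hermite integral -/

/-- The one-variable factor of the integrand of `R_{N,β}(y)`, with `e^{(N-1) ln(iz + y)}` written as
a power; this makes it entire in `z`. -/
noncomputable def hermiteWeight (N : ℕ) (y : ℝ) (z : ℂ) : ℂ :=
  Complex.exp (-2 * N * z ^ 2) * (Complex.I * z + y) ^ (N - 1)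

theorem differentiable_hermiteWeight (N : ℕ) (y : ℝ) : Differentiable ℂ (hermiteWeight N y) := by
  unfold hermiteWeight
  fun_prop

/-- Gaussian decay along horizontal lines, uniform in every disc of translations `ζ`. -/
theorem exists_norm_hermiteWeight_le {N : ℕ} (hN : 1 ≤ N) (y ρ : ℝ) :
    ∃ C b : ℝ, 0 < b ∧ ∀ ζ : ℂ, ‖ζ‖ ≤ ρ → ∀ u : ℝ,
      ‖hermiteWeight N y (u + ζ)‖ ≤ C * Real.exp (-b * u ^ 2) := by
  have hN0 : (0 : ℝ) < N := by exact_mod_cast hN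
  refine ⟨Real.exp (2 * N * ρ ^ 2) * (1 + ρ + |y|) ^ (N - 1) *
    Real.exp (((N - 1 : ℕ) : ℝ) ^ 2 / (2 * N)), N / 2, by positivity, fun ζ hζ u => ?_⟩
  have hρ : 0 ≤ ρ := (norm_nonneg ζ).trans hζ
  have h1 : ‖Complex.exp (-2 * N * (u + ζ) ^ 2)‖ ≤
      Real.exp (2 * N * ρ ^ 2) * Real.exp (-N * u ^ 2) := by
    rw [Complex.norm_exp, ← Real.exp_add]
    refine Real.exp_le_exp.2 ?_
    have e1 : (-2 * N * (u + ζ) ^ 2 : ℂ).re = -2 * N * ((u + ζ.re) ^ 2 - ζ.im ^ 2) := by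
      have : (-2 * N : ℂ) = ((-2 * N : ℝ) : ℂ) := by push_cast; rfl
      rw [this, Complex.re_ofReal_mul, pow_two, Complex.mul_re, Complex.add_re, Complex.add_im,
        Complex.ofReal_re, Complex.ofReal_im]
      ring
    have e2 : ζ.re ^ 2 + ζ.im ^ 2 ≤ ρ ^ 2 := by
      have e3 : ζ.re ^ 2 + ζ.im ^ 2 = ‖ζ‖ ^ 2 := by
        rw [Complex.sq_norm, Complex.normSq_apply]
        ring
      rw [e3]
      gcongr
    have e4 : u ^ 2 / 2 - ρ ^ 2 ≤ (u + ζ.re) ^ 2 - ζ.im ^ 2 := by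
      nlinarith [sq_nonneg (u + 2 * ζ.re)]
    rw [e1]
    nlinarith [mul_le_mul_of_nonneg_left e4 hN0.le]
  have h2 : ‖Complex.I * (u + ζ) + y‖ ≤ (1 + ρ + |y|) * (1 + |u|) := by
    have e1 : ‖Complex.I * (u + ζ) + y‖ ≤ |u| + ρ + |y| := by
      refine (norm_add_le _ _).trans (add_le_add ?_ (by simp))
      rw [norm_mul, Complex.norm_I, one_mul]
      exact (norm_add_le _ _).trans (add_le_add (by simp) hζ)
    nlinarith [abs_nonneg u, abs_nonneg y, mul_nonneg hρ (abs_nonneg u),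
      mul_nonneg (abs_nonneg y) (abs_nonneg u)]
  rw [hermiteWeight, norm_mul, norm_pow]
  have h3 := one_add_abs_pow_mul_exp_neg_le hN0 (N - 1) u
  calc _ ≤ (Real.exp (2 * N * ρ ^ 2) * Real.exp (-N * u ^ 2)) *
        ((1 + ρ + |y|) * (1 + |u|)) ^ (N - 1) := by gcongr
    _ = (Real.exp (2 * N * ρ ^ 2) * (1 + ρ + |y|) ^ (N - 1)) *
        ((1 + |u|) ^ (N - 1) * Real.exp (-N * u ^ 2)) := by
      rw [mul_pow]
      ring
    _ ≤ (Real.exp (2 * N * ρ ^ 2) * (1 + ρ + |y|) ^ (N - 1)) *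
        (Real.exp (((N - 1 : ℕ) : ℝ) ^ 2 / (2 * N)) * Real.exp (-(N / 2) * u ^ 2)) := by gcongr
    _ = _ := by ring

/-- The two sides can differ only where some logarithm is evaluated at `0`, which forces `u_j = 0`
for some `j`. -/
theorem hermiteIntegrand_ae_eq {N β : ℕ} (hN : 1 ≤ N) (y : ℝ) :
    hermiteIntegrand N β y =ᵐ[volume] fun u =>
      (∏ j, hermiteWeight N y (u j)) * (absVandermonde (4 / (β : ℝ)) u : ℂ) := by
  have hae : ∀ᵐ u : Fin β → ℝ, ∀ j, u j ≠ 0 := by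
    rw [ae_all_iff]
    intro j
    exact (Measure.quasiMeasurePreserving_eval (fun _ : Fin β => (volume : Measure ℝ)) j).ae
      (Measure.ae_ne volume (0 : ℝ))
  filter_upwards [hae] with u hu
  rw [hermiteIntegrand, absVandermonde]
  congr 1
  refine Finset.prod_congr rfl fun j _ => ?_
  have hne : Complex.I * (u j : ℂ) + y ≠ 0 := by
    intro h
    have := congrArg Complex.im h
    simp at this
    exact hu j this
  have hNC : (N : ℂ) ≠ 0 := by exact_mod_cast (by omega : N ≠ 0)
  have h1 : (N : ℂ) * hermiteF N (u j) y =
      -2 * N * (u j : ℂ) ^ 2 + ((N - 1 : ℕ) : ℂ) * Complex.log (Complex.I * u j + y) := by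
    rw [hermiteF, Nat.cast_sub hN]
    push_cast
    field_simp
  rw [h1, Complex.exp_add, Complex.exp_nat_mul, Complex.exp_log hne, hermiteWeight]

theorem integrable_hermiteIntegrand {N : ℕ} (hN : 1 ≤ N) (β : ℕ) (y : ℝ) :
    Integrable (hermiteIntegrand N β y) := by
  obtain ⟨C, b, hb, h⟩ := exists_norm_hermiteWeight_le hN y 0
  have hc := (differentiable_hermiteWeight N y).continuous
  exact (integrable_prod_mul_absVandermonde (g := fun u : ℝ => hermiteWeight N y u)
    (by positivity) hb (by fun_prop)
    fun u => by simpa using h 0 (by simp) u).congr (hermiteIntegrand_ae_eq hN y).symm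

/-- The change of variables `u = i/2 - i ε v/2`, `v = c + i t`, in the one-variable factor. -/
theorem hermiteWeight_scaled {N : ℕ} {ε : ℝ} (hε : 0 < ε) (hN : N * ε ^ 3 = 1) (c x t : ℝ) :
    hermiteWeight N (1 + x * ε ^ 2 / 2)
        (((ε / 2 * t : ℝ) : ℂ) + (Complex.I / 2 - Complex.I * (c * ε / 2))) =
      ((Real.exp (N / 2 + x / ε) / 2 ^ (N - 1) : ℝ) : ℂ) * scaledWeight N ε c x t := by
  have hεC : (ε : ℂ) ≠ 0 := by exact_mod_cast hε.ne'
  have hNC : (N : ℂ) = 1 / (ε : ℂ) ^ 3 := by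
    rw [eq_div_iff (pow_ne_zero _ hεC)]
    exact_mod_cast hN
  set z : ℂ := ((ε / 2 * t : ℝ) : ℂ) + (Complex.I / 2 - Complex.I * (c * ε / 2)) with hz
  have h1 : z = Complex.I / 2 * (1 - ε * vert c t) := by
    rw [hz, vert]
    push_cast
    linear_combination (ε * t / 2 : ℂ) * Complex.I_sq
  have h2 : Complex.I * z + ((1 + x * ε ^ 2 / 2 : ℝ) : ℂ) =
      (1 / 2) * (1 + ε * (vert c t + x * ε)) := by
    rw [h1]
    push_cast
    linear_combination ((1 - ε * vert c t) / 2 : ℂ) * Complex.I_sq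
  have h3 : -2 * (N : ℂ) * z ^ 2 = ((N / 2 + x / ε : ℝ) : ℂ) +
      (-vert c t / ε ^ 2 + vert c t ^ 2 / (2 * ε) - x / ε) := by
    rw [h1, mul_pow, div_pow, Complex.I_sq]
    push_cast
    rw [hNC]
    field_simp
    ring
  rw [hermiteWeight, h2, h3, Complex.exp_add, mul_pow, scaledWeight]
  push_cast
  rw [one_div, inv_pow]
  ring

/-- The contours are moved together to `Im u = (1 - cε)/2`, just below the saddle point `i/2`, and
rescaled by `ε/2`. -/
theorem hermiteR_eq {N β : ℕ} (hN1 : 1 ≤ N) {ε : ℝ} (hε : 0 < ε) (hN : N * ε ^ 3 = 1)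
    (c x : ℝ) :
    hermiteR N β (1 + x * ε ^ 2 / 2) =
      (((Real.exp (N / 2 + x / ε) / 2 ^ (N - 1)) ^ β * (ε / 2) ^ β *
        ((ε / 2) ^ (4 / (β : ℝ))) ^ (β * (β - 1) / 2) : ℝ) : ℂ) *
      ∫ t : Fin β → ℝ, (∏ j, scaledWeight N ε c x (t j)) *
        (absVandermonde (4 / (β : ℝ)) t : ℂ) := by
  have hε2 : 0 < ε / 2 := half_pos hε
  rw [hermiteR, integral_congr_ae (hermiteIntegrand_ae_eq hN1 _),
    ← integral_prod_mul_absVandermonde_translate (by positivity)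
      (differentiable_hermiteWeight N _) (exists_norm_hermiteWeight_le hN1 _)
      (Complex.I / 2 - Complex.I * (c * ε / 2))]
  set G : (Fin β → ℝ) → ℂ := fun u =>
    (∏ j, hermiteWeight N (1 + x * ε ^ 2 / 2)
      ((u j : ℂ) + (Complex.I / 2 - Complex.I * (c * ε / 2)))) *
        (absVandermonde (4 / (β : ℝ)) u : ℂ) with hG
  have hscale : ∫ u, G u = (((ε / 2) ^ β : ℝ) : ℂ) * ∫ t, G ((ε / 2) • t) := by
    rw [Measure.integral_comp_smul, Module.finrank_fin_fun, abs_of_pos (by positivity),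
      Complex.real_smul, ← mul_assoc, ← Complex.ofReal_mul, mul_inv_cancel₀ (by positivity),
      Complex.ofReal_one, one_mul]
  have hGt : ∀ t, G ((ε / 2) • t) =
      (((Real.exp (N / 2 + x / ε) / 2 ^ (N - 1)) ^ β *
        ((ε / 2) ^ (4 / (β : ℝ))) ^ (β * (β - 1) / 2) : ℝ) : ℂ) *
      ((∏ j, scaledWeight N ε c x (t j)) * (absVandermonde (4 / (β : ℝ)) t : ℂ)) := by
    intro t
    simp only [hG, Pi.smul_apply, smul_eq_mul, hermiteWeight_scaled hε hN,
      absVandermonde_smul _ hε2.le, Finset.prod_mul_distrib, Finset.prod_const, Finset.card_univ,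
      Fintype.card_fin]
    push_cast
    ring
  rw [hscale]
  simp only [hGt]
  rw [integral_const_mul, ← mul_assoc, ← Complex.ofReal_mul]
  congr 2
  ring

/-- The powers of `ε/2 = N^{-1/3}/2` collected from the Jacobian and from the weight. -/
theorem hermite_prefactor_eq {N β : ℕ} (hN : 1 ≤ N) (hβ : 0 < β) (x : ℝ) :
    (Real.exp (N / 2 + x / (N : ℝ) ^ (-(1 / 3) : ℝ)) / 2 ^ (N - 1)) ^ β *
        ((N : ℝ) ^ (-(1 / 3) : ℝ) / 2) ^ β *
        (((N : ℝ) ^ (-(1 / 3) : ℝ) / 2) ^ (4 / (β : ℝ))) ^ (β * (β - 1) / 2) =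
      4 / 4 ^ β * (Real.exp ((β : ℝ) * N / 2 + β * (N : ℝ) ^ (1 / 3 : ℝ) * x) /
        ((2 : ℝ) ^ (β * N) * (N : ℝ) ^ ((β : ℝ) - 2 / 3))) := by
  have hN0 : (0 : ℝ) < N := by exact_mod_cast hN
  have hβC : (β : ℝ) ≠ 0 := by exact_mod_cast hβ.ne'
  set ε : ℝ := (N : ℝ) ^ (-(1 / 3) : ℝ) with hε
  have hε0 : 0 < ε := Real.rpow_pos_of_pos hN0 _
  have h1 : ((ε / 2) ^ (4 / (β : ℝ))) ^ (β * (β - 1) / 2) = (ε / 2) ^ (2 * (β - 1)) := by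
    rw [← Real.rpow_natCast, ← Real.rpow_mul (by positivity), ← Real.rpow_natCast (ε / 2)]
    congr 1
    rw [Nat.cast_div (Nat.even_mul_pred_self β).two_dvd two_ne_zero]
    push_cast
    field_simp
    ring
  have h2 : ε ^ β * ε ^ (2 * (β - 1)) = ((N : ℝ) ^ ((β : ℝ) - 2 / 3))⁻¹ := by
    rw [← pow_add, hε, ← Real.rpow_natCast, ← Real.rpow_mul hN0.le, ← Real.rpow_neg hN0.le]
    congr 1
    rw [Nat.cast_add, Nat.cast_mul, Nat.cast_sub hβ]
    push_cast
    ring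
  have h3 : x / ε = (N : ℝ) ^ (1 / 3 : ℝ) * x := by
    rw [hε, Real.rpow_neg hN0.le]
    field_simp
  have h4 : Real.exp (N / 2 + x / ε) ^ β =
      Real.exp ((β : ℝ) * N / 2 + β * (N : ℝ) ^ (1 / 3 : ℝ) * x) := by
    rw [← Real.exp_nat_mul, h3]
    ring_nf
  have h5 : (2 : ℝ) ^ (β * N) = ((2 : ℝ) ^ (N - 1)) ^ β * 2 ^ β := by
    rw [← mul_pow, ← pow_succ, Nat.sub_add_cancel hN, ← pow_mul, mul_comm]
  have h6 : (4 : ℝ) ^ β = 4 * 2 ^ (2 * (β - 1)) := by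
    rw [pow_mul, show (2 : ℝ) ^ 2 = 4 by norm_num, ← pow_succ', Nat.sub_add_cancel hβ]
  rw [h1, div_pow, div_pow, div_pow, h4, h5, h6]
  have h7 : ∀ E p q r : ℝ, E / p * (ε ^ β / q) * (ε ^ (2 * (β - 1)) / r) =
      E / p / q / r * (ε ^ β * ε ^ (2 * (β - 1))) := by
    intro E p q r
    ring
  rw [h7, h2]
  field_simp

/-! ### The asymptotic formula -/

theorem mainTheorem7 (β : ℕ) (hβ : Even β) (hβ0 : 0 < β) (x c : ℝ) (hc : 0 < c) :
    (∀ N : ℕ, 1 ≤ N → ∀ y : ℝ, Integrable (hermiteIntegrand N β y)) ∧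
    IntegrableOn (kontsevichIntegrand β (β : ℝ) c x) (nested β) ∧
    (fun N : ℕ =>
        hermiteR N β (1 + x / (2 * (N : ℝ) ^ (2 / 3 : ℝ))) -
          ((4 * (Real.pi / 2) ^ β *
              (Real.exp ((β : ℝ) * N / 2 + β * (N : ℝ) ^ (1 / 3 : ℝ) * x) /
                ((2 : ℝ) ^ (β * N) * (N : ℝ) ^ ((β : ℝ) - 2 / 3))) : ℝ) : ℂ) *
            kontsevichK β (β : ℝ) c x)
      =O[atTop]
    (fun N : ℕ =>
        Real.exp ((β : ℝ) * N / 2 + β * (N : ℝ) ^ (1 / 3 : ℝ) * x) / (2 : ℝ) ^ (β * N) *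
          (N : ℝ) ^ (-(β : ℝ) + 1 / 3)) := by
  refine ⟨fun N hN y => integrable_hermiteIntegrand hN β y,
    integrableOn_kontsevichIntegrand (by positivity) hc x, ?_⟩
  obtain ⟨K, ε₀, hε₀, hK⟩ := exists_norm_integral_sub_le (n := β) (a := 4 / (β : ℝ))
    (by positivity) hc x
  have hlim : Tendsto (fun N : ℕ => (N : ℝ) ^ (-(1 / 3) : ℝ)) atTop (nhds 0) :=
    (tendsto_rpow_neg_atTop (by norm_num)).comp tendsto_natCast_atTop_atTop
  refine IsBigO.of_bound (4 / 4 ^ β * K) ?_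
  filter_upwards [hlim.eventually (gt_mem_nhds hε₀), eventually_ge_atTop 1] with N hsmall hN
  have hN0 : (0 : ℝ) < N := by exact_mod_cast hN
  have hpre := hermite_prefactor_eq hN hβ0 x
  set ε : ℝ := (N : ℝ) ^ (-(1 / 3) : ℝ) with hε
  have hε0 : 0 < ε := Real.rpow_pos_of_pos hN0 _
  have hNε : N * ε ^ 3 = 1 := by
    rw [hε, ← Real.rpow_natCast, ← Real.rpow_mul hN0.le]
    norm_num
    rw [Real.rpow_neg_one, mul_inv_cancel₀ hN0.ne']
  have hy : x / (2 * (N : ℝ) ^ (2 / 3 : ℝ)) = x * ε ^ 2 / 2 := by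
    have h1 : ε ^ 2 = ((N : ℝ) ^ (2 / 3 : ℝ))⁻¹ := by
      rw [hε, ← Real.rpow_natCast, ← Real.rpow_mul hN0.le, ← Real.rpow_neg hN0.le]
      norm_num
    rw [h1]
    field_simp
  set E : ℝ := Real.exp ((β : ℝ) * N / 2 + β * (N : ℝ) ^ (1 / 3 : ℝ) * x) with hE
  rw [hy, hermiteR_eq hN hε0 hNε c x, hpre, kontsevichK_eq hβ hβ0 hc]
  set J := ∫ t : Fin β → ℝ, (∏ j, scaledWeight N ε c x (t j)) *
    (absVandermonde (4 / (β : ℝ)) t : ℂ)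
  set J' := ∫ t : Fin β → ℝ, (∏ j, cubicExp c x (t j)) * (absVandermonde (4 / (β : ℝ)) t : ℂ)
  set Q : ℝ := 4 / 4 ^ β * (E / ((2 : ℝ) ^ (β * N) * (N : ℝ) ^ ((β : ℝ) - 2 / 3))) with hQ
  have hQ0 : 0 ≤ Q := by positivity
  have hcoef : ((4 * (Real.pi / 2) ^ β *
      (E / ((2 : ℝ) ^ (β * N) * (N : ℝ) ^ ((β : ℝ) - 2 / 3))) : ℝ) : ℂ) *
        (1 / (2 * (Real.pi : ℂ)) ^ β * J') = (Q : ℂ) * J' := by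
    have h1 : 4 * (Real.pi / 2) ^ β *
        (E / ((2 : ℝ) ^ (β * N) * (N : ℝ) ^ ((β : ℝ) - 2 / 3))) * (1 / (2 * Real.pi) ^ β) = Q := by
      have h4 : (4 : ℝ) ^ β = 2 ^ β * 2 ^ β := by rw [← mul_pow]; norm_num
      have hpi : Real.pi ^ β ≠ 0 := pow_ne_zero _ Real.pi_ne_zero
      rw [hQ, div_pow, mul_pow, h4]
      field_simp
    rw [← h1, ← mul_assoc]
    push_cast
    rfl
  rw [hcoef, ← mul_sub, norm_mul, Complex.norm_of_nonneg hQ0, Real.norm_of_nonneg (by positivity)]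
  have hrate : ε / (N : ℝ) ^ ((β : ℝ) - 2 / 3) = (N : ℝ) ^ (-(β : ℝ) + 1 / 3) := by
    rw [hε, ← Real.rpow_sub hN0]
    ring_nf
  calc Q * ‖J - J'‖ ≤ Q * (K * ε) := by
        gcongr
        exact hK N ε hε0 hsmall.le hNε
    _ = 4 / 4 ^ β * K * (E / 2 ^ (β * N) * (ε / (N : ℝ) ^ ((β : ℝ) - 2 / 3))) := by
        rw [hQ]
        field_simp
    _ = _ := by rw [hrate]
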